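/- For $n\ge 1$ let $\mathcal G_n$ denote the $2$-by-$n$ grid graph, that is, the graph with vertex set $\{0,1\}\times\{0,\dots,n-1\}$ in which two vertices are adjacent if and only if they agree in one coordinate and differ by exactly $1$ in the other. Let $T_n$ be the number of spanning trees of $\mathcal G_n$, and let $S_n$ be the number of balanced spanning trees of $\mathcal G_n$, where a spanning tree is called balanced if it contains an edge whose removal splits it into two connected components with equally many vertices. Let $m\ge 1$ be an integer. 1. If $n=2m+1$, then $$S_n = n+\sum_{i=0}^{m-1}(6+4i)\,T_{m-i}^2 .$$ 2. If $n=2m$, then $$S_n = n+2\,T_m^2+\sum_{i=1}^{m-1}(4+4i)\,T_{m-i}^2 .$$ -/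

import Mathlib

namespace BalancedTrees

/-- The `2`-by-`n` grid graph: vertices `(i, j)` with `i < 2` and `j < n`, two vertices being
adjacent when they agree in one coordinate and differ by one in the other. -/
def grid (n : ℕ) : SimpleGraph (Fin 2 × Fin n) :=
  (SimpleGraph.pathGraph 2).boxProd (SimpleGraph.pathGraph n)

/-- The spanning trees of `G`: trees on the whole vertex set of `G` all of whose edges are
edges of `G`. -/
def spanningTrees {V : Type*} (G : SimpleGraph V) : Set (SimpleGraph V) :=
  {T | T ≤ G ∧ T.IsTree}

/-- `e` is a balanced cut edge of `T`: it is an edge of `T`, and removing it partitions the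
vertices into exactly two connected components, which have the same number of vertices. -/
def IsBalancedCutEdge {V : Type*} (T : SimpleGraph V) (e : Sym2 V) : Prop :=
  e ∈ T.edgeSet ∧
    ∃ C D : (T.deleteEdges {e}).ConnectedComponent,
      C ≠ D ∧ (∀ X : (T.deleteEdges {e}).ConnectedComponent, X = C ∨ X = D) ∧
        C.supp.ncard = D.supp.ncard

/-- The balanced spanning trees of `G`: those that contain a balanced cut edge. -/
def balancedSpanningTrees {V : Type*} (G : SimpleGraph V) : Set (SimpleGraph V) :=
  {T | T ∈ spanningTrees G ∧ ∃ e, IsBalancedCutEdge T e}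

/-- The number of spanning trees of the `2`-by-`n` grid, with the convention that it is `1`
for `n = 0`. -/
noncomputable def numTrees (n : ℕ) : ℕ :=
  if n = 0 then 1 else (spanningTrees (grid n)).ncard

/-- The number of balanced spanning trees of the `2`-by-`n` grid. -/
noncomputable def numBalanced (n : ℕ) : ℕ :=
  (balancedSpanningTrees (grid n)).ncard

end BalancedTrees

/-! A spanning tree of the grid is balanced exactly when the `2n` vertices split into halves `A` and
`Aᶜ`, each inducing a connected subgraph of the tree (`exists_isBalancedCutEdge_iff`). Requiring
`(0, 0) ∈ A` names the halves. If both halves are merely connected in the grid, then `A` is a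
staircase: the first `i` vertices of row `0` and the first `n - i` of row `1`, with `1 ≤ i ≤ n`
(`eq_staircase`). Two different staircases cross, so no tree is connected on both sides of both
(`not_connOn_of_crossing`), and the balanced trees are a disjoint union over `i`.

For fixed `i`, such a tree is a spanning tree of each half plus one edge between them
(`ncard_splitTrees`). Stripping leaves from the longer row reduces a staircase to a square grid with
`min i (n - i)` columns, and the complement is its half turn, so the trees contribute `numTrees (min
i (n - i)) ^ 2`. For `i < n` the connecting edges are two horizontal ones and `|2i - n|` rungs; for
`i = n` the halves are the two rows, joined by `n` rungs. Folding the sum about `i = n / 2` gives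
the two formulas. -/

namespace BalancedTrees

open SimpleGraph

variable {V W : Type*}

/-! ### Spanning trees of induced subgraphs -/

/-- The graph on the same vertex set keeping only the edges of `T` with both ends in `A`. -/
def restrictTo (T : SimpleGraph V) (A : Set V) : SimpleGraph V where
  Adj u v := T.Adj u v ∧ u ∈ A ∧ v ∈ A
  symm := ⟨fun _ _ h => ⟨h.1.symm, h.2.2, h.2.1⟩⟩
  loopless := ⟨fun _ h => h.1.ne rfl⟩

@[simp] lemma restrictTo_adj {T : SimpleGraph V} {A : Set V} {u v : V} :
    (restrictTo T A).Adj u v ↔ T.Adj u v ∧ u ∈ A ∧ v ∈ A := Iff.rfl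

lemma restrictTo_le (T : SimpleGraph V) (A : Set V) : restrictTo T A ≤ T := fun _ _ h => h.1

lemma restrictTo_restrictTo (T : SimpleGraph V) (A : Set V) :
    restrictTo (restrictTo T A) A = restrictTo T A := by
  ext u v; simp

/-- `T` induces a (pre)connected graph on `A`. -/
def ConnOn (T : SimpleGraph V) (A : Set V) : Prop :=
  ∀ u ∈ A, ∀ v ∈ A, (restrictTo T A).Reachable u v

/-- The spanning trees of the subgraph of `G` induced on `A`, as graphs on the vertices of `G`. -/
def treesOn (G : SimpleGraph V) (A : Set V) : Set (SimpleGraph V) :=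
  {T | T ≤ G ∧ restrictTo T A = T ∧ T.IsAcyclic ∧ ConnOn T A}

/-- The edges of `G` from `A` to `B`, oriented. -/
def crossing (G : SimpleGraph V) (A B : Set V) : Set (V × V) :=
  {p | p.1 ∈ A ∧ p.2 ∈ B ∧ G.Adj p.1 p.2}

/-- The spanning trees on `A ∪ B` that are connected on `A` and on `B`. -/
def splitTrees (G : SimpleGraph V) (A B : Set V) : Set (SimpleGraph V) :=
  {T | T ∈ treesOn G (A ∪ B) ∧ ConnOn T A ∧ ConnOn T B}

/-- Weaker than a homomorphism: edges may be collapsed, so retractions onto a vertex set can be used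
to transport reachability. -/
lemma reachable_of_map {H : SimpleGraph V} {K : SimpleGraph W} (f : V → W)
    (hf : ∀ x y, H.Adj x y → K.Reachable (f x) (f y)) {x y : V} (h : H.Reachable x y) :
    K.Reachable (f x) (f y) := by
  obtain ⟨p⟩ := h
  induction p with
  | nil => exact Reachable.refl _
  | cons h _ ih => exact (hf _ _ h).trans ih

lemma isAcyclic_iff_not_reachable {T : SimpleGraph V} :
    T.IsAcyclic ↔ ∀ u v, T.Adj u v → ¬ (T.deleteEdges {s(u, v)}).Reachable u v := by
  rw [isAcyclic_iff_forall_adj_isBridge]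
  exact forall₂_congr fun u v => by rw [isBridge_iff]

lemma deleteEdges_adj_mono {H K : SimpleGraph V} {u v x y : V}
    (h : (H.deleteEdges {s(u, v)}).Adj x y) (hK : K.Adj x y) :
    (K.deleteEdges {s(u, v)}).Adj x y := by
  rw [deleteEdges_adj] at h ⊢
  exact ⟨hK, h.2⟩

lemma mem_of_restrictTo_eq {T : SimpleGraph V} {A : Set V} (h : restrictTo T A = T) {u v : V}
    (huv : T.Adj u v) : u ∈ A ∧ v ∈ A := by
  rw [← h] at huv; exact huv.2

lemma mem_treesOn_univ [Nonempty V] {G T : SimpleGraph V} :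
    T ∈ treesOn G Set.univ ↔ T ∈ spanningTrees G := by
  have h : restrictTo T Set.univ = T := by ext; simp
  simp only [treesOn, spanningTrees, ConnOn, Set.mem_ofPred_eq, h, isTree_iff, connected_iff,
    Preconnected, Set.mem_univ, true_and, true_imp_iff]
  tauto

lemma ConnOn.mono {T S : SimpleGraph V} {A : Set V} (h : ConnOn T A)
    (hTS : ∀ u ∈ A, ∀ v ∈ A, T.Adj u v → S.Adj u v) : ConnOn S A :=
  fun u hu v hv => (h u hu v hv).mono fun _ _ h' => by
    exact ⟨hTS _ h'.2.1 _ h'.2.2 h'.1, h'.2⟩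

/-! ### Gluing two trees along an edge, and splitting them again -/

/-- Two trees joined by an edge. -/
def glue (T₁ T₂ : SimpleGraph V) (a b : V) : SimpleGraph V := T₁ ⊔ T₂ ⊔ edge a b

lemma glue_comm (T₁ T₂ : SimpleGraph V) (a b : V) : glue T₁ T₂ a b = glue T₂ T₁ b a := by
  rw [glue, glue, sup_comm T₁, edge_comm]

lemma glue_adj {T₁ T₂ : SimpleGraph V} {a b u v : V} :
    (glue T₁ T₂ a b).Adj u v ↔
      T₁.Adj u v ∨ T₂.Adj u v ∨ ((u = a ∧ v = b ∨ u = b ∧ v = a) ∧ u ≠ v) := by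
  simp only [glue, sup_adj, edge_adj, or_assoc]

section Glue

variable {G T₁ T₂ : SimpleGraph V} {A B : Set V} {a b : V}

/-- Retract onto `A` by sending every other vertex to `a`. Edges of `T₂` and the joining edge
collapse to `a`, so a detour around `s(u, v)` in the glued graph would become one inside `T₁`. -/
lemma glue_not_reachable_of_left (hAB : Disjoint A B) (h₁ : restrictTo T₁ A = T₁)
    (h₂ : restrictTo T₂ B = T₂) (hac : T₁.IsAcyclic) (ha : a ∈ A) (hb : b ∈ B) {u v : V}
    (huv : T₁.Adj u v) : ¬ ((glue T₁ T₂ a b).deleteEdges {s(u, v)}).Reachable u v := by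
  classical
  intro h
  refine isAcyclic_iff_not_reachable.1 hac u v huv ?_
  obtain ⟨hu, hv⟩ := mem_of_restrictTo_eq h₁ huv
  have key := reachable_of_map (K := T₁.deleteEdges {s(u, v)})
    (fun x => if x ∈ A then x else a) ?_ h
  · simpa [hu, hv] using key
  intro x y hxy
  have hxy' := hxy
  rw [deleteEdges_adj, glue_adj] at hxy'
  rcases hxy'.1 with h' | h' | ⟨⟨rfl, rfl⟩ | ⟨rfl, rfl⟩, -⟩
  · obtain ⟨hx, hy⟩ := mem_of_restrictTo_eq h₁ h'
    simpa [hx, hy] using (deleteEdges_adj_mono hxy h').reachable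
  · obtain ⟨hx, hy⟩ := mem_of_restrictTo_eq h₂ h'
    simp [Set.disjoint_right.1 hAB hx, Set.disjoint_right.1 hAB hy]
  · simp [ha, Set.disjoint_right.1 hAB hb]
  · simp [ha, Set.disjoint_right.1 hAB hb]

lemma glue_isAcyclic (hAB : Disjoint A B) (h₁ : restrictTo T₁ A = T₁)
    (h₂ : restrictTo T₂ B = T₂) (hac₁ : T₁.IsAcyclic) (hac₂ : T₂.IsAcyclic)
    (ha : a ∈ A) (hb : b ∈ B) : (glue T₁ T₂ a b).IsAcyclic := by
  have hd : ∀ x, x ∈ A → x ∉ B := fun _ h => Set.disjoint_left.1 hAB h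
  have hcut : ¬ ((glue T₁ T₂ a b).deleteEdges {s(a, b)}).Reachable a b := by
    intro h
    -- Membership in `A` is constant along every edge other than `s(a, b)`, hence along walks: it is
    -- a map to the edgeless graph on `Prop`.
    have key := reachable_of_map (K := (⊥ : SimpleGraph Prop)) (fun x => x ∈ A) ?_ h
    · rw [reachable_bot] at key
      exact hd b (key.mp ha) hb
    intro x y hxy
    rw [deleteEdges_adj, glue_adj] at hxy
    rw [reachable_bot]
    rcases hxy.1 with h' | h' | h'
    · have := mem_of_restrictTo_eq h₁ h'
      simp [this.1, this.2]
    · have := mem_of_restrictTo_eq h₂ h'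
      simp [Set.disjoint_right.1 hAB this.1, Set.disjoint_right.1 hAB this.2]
    · exfalso
      apply hxy.2
      rcases h'.1 with ⟨rfl, rfl⟩ | ⟨rfl, rfl⟩ <;> simp [Sym2.eq_swap]
  rw [isAcyclic_iff_not_reachable]
  intro u v huv
  rcases glue_adj.1 huv with h | h | ⟨⟨rfl, rfl⟩ | ⟨rfl, rfl⟩, -⟩
  · exact glue_not_reachable_of_left hAB h₁ h₂ hac₁ ha hb h
  · rw [glue_comm]
    exact glue_not_reachable_of_left hAB.symm h₂ h₁ hac₂ hb ha h
  · exact hcut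
  · rw [Sym2.eq_swap]
    exact fun h => hcut h.symm

lemma restrictTo_glue (hAB : Disjoint A B) (h₁ : restrictTo T₁ A = T₁)
    (h₂ : restrictTo T₂ B = T₂) (hb : b ∈ B) : restrictTo (glue T₁ T₂ a b) A = T₁ := by
  have hd : ∀ x, x ∈ A → x ∉ B := fun _ h => Set.disjoint_left.1 hAB h
  ext u v
  rw [restrictTo_adj, glue_adj]
  constructor
  · rintro ⟨h | h | ⟨⟨rfl, rfl⟩ | ⟨rfl, rfl⟩, -⟩, hu, hv⟩
    · exact h
    · exact absurd (mem_of_restrictTo_eq h₂ h).1 (hd _ hu)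
    · exact absurd hb (hd _ hv)
    · exact absurd hb (hd _ hu)
  · exact fun h => ⟨Or.inl h, mem_of_restrictTo_eq h₁ h⟩

lemma glue_mem_splitTrees (hAB : Disjoint A B) (h₁ : T₁ ∈ treesOn G A) (h₂ : T₂ ∈ treesOn G B)
    (hab : (a, b) ∈ crossing G A B) : glue T₁ T₂ a b ∈ splitTrees G A B := by
  obtain ⟨hle₁, hr₁, hac₁, hc₁⟩ := h₁
  obtain ⟨hle₂, hr₂, hac₂, hc₂⟩ := h₂
  obtain ⟨ha, hb, hG⟩ := hab
  simp only at ha hb hG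
  have hcA : ConnOn (glue T₁ T₂ a b) A := hc₁.mono fun _ _ _ _ h => glue_adj.2 (Or.inl h)
  have hcB : ConnOn (glue T₁ T₂ a b) B :=
    hc₂.mono fun _ _ _ _ h => glue_adj.2 (Or.inr (Or.inl h))
  have hr : restrictTo (glue T₁ T₂ a b) (A ∪ B) = glue T₁ T₂ a b := by
    ext u v
    rw [restrictTo_adj, and_iff_left_iff_imp, glue_adj]
    rintro (h | h | ⟨⟨rfl, rfl⟩ | ⟨rfl, rfl⟩, -⟩)
    · exact (mem_of_restrictTo_eq hr₁ h).imp Or.inl Or.inl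
    · exact (mem_of_restrictTo_eq hr₂ h).imp Or.inr Or.inr
    · exact ⟨Or.inl ha, Or.inr hb⟩
    · exact ⟨Or.inr hb, Or.inl ha⟩
  refine ⟨⟨?_, hr, glue_isAcyclic hAB hr₁ hr₂ hac₁ hac₂ ha hb, ?_⟩, hcA, hcB⟩
  · intro u v h
    rcases glue_adj.1 h with h | h | ⟨⟨rfl, rfl⟩ | ⟨rfl, rfl⟩, -⟩
    exacts [hle₁ h, hle₂ h, hG, hG.symm]
  · have hne : a ≠ b := hG.ne
    have hpath : (glue T₁ T₂ a b).Reachable a b :=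
      (glue_adj.2 (Or.inr (Or.inr ⟨Or.inl ⟨rfl, rfl⟩, hne⟩))).reachable
    have hto : ∀ u ∈ A ∪ B, (glue T₁ T₂ a b).Reachable a u := by
      rintro u (hu | hu)
      · exact (hcA a ha u hu).mono (restrictTo_le _ _)
      · exact hpath.trans ((hcB b hb u hu).mono (restrictTo_le _ _))
    intro u hu v hv
    rw [hr]
    exact (hto u hu).symm.trans (hto v hv)

end Glue

lemma restrictTo_le_deleteEdges (T : SimpleGraph V) {A : Set V} {b : V} (a : V) (hb : b ∉ A) :
    restrictTo T A ≤ T.deleteEdges {s(a, b)} := by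
  intro x y h
  rw [deleteEdges_adj]
  refine ⟨h.1, ?_⟩
  simp only [Set.mem_singleton_iff, Sym2.eq_iff]
  rintro (⟨rfl, rfl⟩ | ⟨rfl, rfl⟩)
  exacts [hb h.2.2, hb h.2.1]

/-- A second crossing edge, together with paths inside `A` and inside `B`, would bypass the first
one and close a cycle. -/
lemma crossing_eq_of_isAcyclic {T : SimpleGraph V} {A B : Set V} (hac : T.IsAcyclic)
    (hAB : Disjoint A B) (hA : ConnOn T A) (hB : ConnOn T B) {p q : V × V}
    (hp : p ∈ crossing T A B) (hq : q ∈ crossing T A B) : p = q := by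
  obtain ⟨a, b⟩ := p
  obtain ⟨a', b'⟩ := q
  obtain ⟨ha, hb, hab⟩ := hp
  obtain ⟨ha', hb', hab'⟩ := hq
  simp only at *
  have hd : ∀ x, x ∈ A → x ∉ B := fun _ h => Set.disjoint_left.1 hAB h
  by_contra hne
  refine isAcyclic_iff_not_reachable.1 hac a b hab ?_
  have h1 : (T.deleteEdges {s(a, b)}).Reachable a a' :=
    (hA a ha a' ha').mono (restrictTo_le_deleteEdges T a fun h => hd _ h hb)
  have h2 : (T.deleteEdges {s(a, b)}).Reachable b' b := by
    rw [Sym2.eq_swap]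
    exact (hB b' hb' b hb).mono (restrictTo_le_deleteEdges T b (hd a ha))
  have h3 : (T.deleteEdges {s(a, b)}).Adj a' b' := by
    rw [deleteEdges_adj]
    refine ⟨hab', ?_⟩
    simp only [Set.mem_singleton_iff, Sym2.eq_iff]
    rintro (⟨rfl, rfl⟩ | ⟨rfl, rfl⟩)
    · exact hne rfl
    · exact hd _ ha hb'
  exact h1.trans (h3.reachable.trans h2)

/-- Walking from inside `S` to outside `S` one uses an edge leaving `S`. -/
lemma exists_adj_of_reachable {T : SimpleGraph V} (S : Set V) {u v : V} (h : T.Reachable u v)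
    (hu : u ∈ S) (hv : v ∉ S) : ∃ x y, T.Adj x y ∧ x ∈ S ∧ y ∉ S := by
  by_contra! hcon
  obtain ⟨p⟩ := h
  induction p with
  | nil => exact hv hu
  | cons h _ ih => exact ih (hcon _ _ h hu) hv

section Split

variable {G : SimpleGraph V} {A B : Set V}

lemma restrictTo_mem_treesOn {T : SimpleGraph V} (hle : T ≤ G) (hac : T.IsAcyclic)
    (hA : ConnOn T A) : restrictTo T A ∈ treesOn G A :=
  ⟨(restrictTo_le _ _).trans hle, restrictTo_restrictTo _ _, hac.anti (restrictTo_le _ _),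
    fun u hu v hv => by rw [restrictTo_restrictTo]; exact hA u hu v hv⟩

lemma exists_crossing {T : SimpleGraph V} (hAB : Disjoint A B) (hA : A.Nonempty)
    (hB : B.Nonempty) (h : ConnOn T (A ∪ B)) : ∃ a b, (a, b) ∈ crossing T A B := by
  obtain ⟨a, ha⟩ := hA
  obtain ⟨b, hb⟩ := hB
  obtain ⟨x, y, hxy, hx, hy⟩ := exists_adj_of_reachable A (h a (Or.inl ha) b (Or.inr hb)) ha
    (fun h => Set.disjoint_left.1 hAB h hb)
  exact ⟨x, y, hx, hxy.2.2.resolve_left hy, hxy.1⟩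

lemma eq_glue_of_mem_splitTrees (hAB : Disjoint A B) {T : SimpleGraph V}
    (hT : T ∈ splitTrees G A B) {a b : V} (hab : (a, b) ∈ crossing T A B) :
    glue (restrictTo T A) (restrictTo T B) a b = T := by
  obtain ⟨⟨hle, hr, hac, hc⟩, hA, hB⟩ := hT
  ext u v
  rw [glue_adj]
  constructor
  · rintro (h | h | ⟨⟨rfl, rfl⟩ | ⟨rfl, rfl⟩, -⟩)
    exacts [h.1, h.1, hab.2.2, hab.2.2.symm]
  · intro h
    obtain ⟨hu | hu, hv | hv⟩ := mem_of_restrictTo_eq hr h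
    · exact Or.inl ⟨h, hu, hv⟩
    · have := crossing_eq_of_isAcyclic hac hAB hA hB hab (q := (u, v)) ⟨hu, hv, h⟩
      simp only [Prod.mk.injEq] at this
      exact Or.inr (Or.inr ⟨Or.inl ⟨this.1.symm, this.2.symm⟩, h.ne⟩)
    · have := crossing_eq_of_isAcyclic hac hAB hA hB hab (q := (v, u)) ⟨hv, hu, h.symm⟩
      simp only [Prod.mk.injEq] at this
      exact Or.inr (Or.inr ⟨Or.inr ⟨this.2.symm, this.1.symm⟩, h.ne⟩)
    · exact Or.inr (Or.inl ⟨h, hu, hv⟩)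

/-- Gluing is a bijection from triples (tree on `A`, tree on `B`, crossing edge): restriction
recovers the trees, and uniqueness of the crossing edge recovers the edge. -/
theorem ncard_splitTrees (hAB : Disjoint A B) (hA : A.Nonempty) (hB : B.Nonempty) :
    (splitTrees G A B).ncard =
      (treesOn G A).ncard * (treesOn G B).ncard * (crossing G A B).ncard := by
  rw [← Set.ncard_prod, ← Set.ncard_prod]
  have himg : splitTrees G A B = (fun q : (SimpleGraph V × SimpleGraph V) × (V × V) =>
      glue q.1.1 q.1.2 q.2.1 q.2.2) '' ((treesOn G A ×ˢ treesOn G B) ×ˢ crossing G A B) := by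
    apply Set.Subset.antisymm
    · intro T hT
      obtain ⟨a, b, hab⟩ := exists_crossing hAB hA hB hT.1.2.2.2
      refine ⟨((restrictTo T A, restrictTo T B), (a, b)), ⟨⟨?_, ?_⟩, ?_⟩,
        eq_glue_of_mem_splitTrees hAB hT hab⟩
      · exact restrictTo_mem_treesOn hT.1.1 hT.1.2.2.1 hT.2.1
      · exact restrictTo_mem_treesOn hT.1.1 hT.1.2.2.1 hT.2.2
      · exact ⟨hab.1, hab.2.1, hT.1.1 hab.2.2⟩
    · rintro _ ⟨⟨⟨T₁, T₂⟩, ⟨a, b⟩⟩, ⟨⟨h₁, h₂⟩, hab⟩, rfl⟩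
      exact glue_mem_splitTrees hAB h₁ h₂ hab
  rw [himg, Set.InjOn.ncard_image]
  rintro ⟨⟨T₁, T₂⟩, ⟨a, b⟩⟩ ⟨⟨h₁, h₂⟩, hab⟩ ⟨⟨S₁, S₂⟩, ⟨c, d⟩⟩ ⟨⟨k₁, k₂⟩, hcd⟩ heq
  simp only at *
  have e₁ : T₁ = S₁ := by
    rw [← restrictTo_glue hAB h₁.2.1 h₂.2.1 (a := a) hab.2.1, heq,
      restrictTo_glue hAB k₁.2.1 k₂.2.1 hcd.2.1]
  have e₂ : T₂ = S₂ := by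
    rw [← restrictTo_glue hAB.symm h₂.2.1 h₁.2.1 (a := b) hab.1, ← glue_comm, heq, glue_comm,
      restrictTo_glue hAB.symm k₂.2.1 k₁.2.1 hcd.1]
  have hT := glue_mem_splitTrees hAB h₁ h₂ hab
  have e₃ : (a, b) = (c, d) := by
    refine crossing_eq_of_isAcyclic hT.1.2.2.1 hAB hT.2.1 hT.2.2
      ⟨hab.1, hab.2.1, glue_adj.2 (Or.inr (Or.inr ⟨Or.inl ⟨rfl, rfl⟩, hab.2.2.ne⟩))⟩
      ⟨hcd.1, hcd.2.1, ?_⟩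
    rw [heq]
    exact glue_adj.2 (Or.inr (Or.inr ⟨Or.inl ⟨rfl, rfl⟩, hcd.2.2.ne⟩))
  rw [e₁, e₂, e₃]

end Split

/-! ### Tree counts under leaf removal and graph embeddings -/

lemma connOn_singleton (T : SimpleGraph V) (v : V) : ConnOn T {v} := by
  rintro u rfl w rfl
  exact Reachable.refl _

lemma ncard_treesOn_singleton (G : SimpleGraph V) (v : V) : (treesOn G {v}).ncard = 1 := by
  rw [Set.ncard_eq_one]
  refine ⟨⊥, Set.eq_singleton_iff_unique_mem.2 ⟨⟨bot_le, ?_, isAcyclic_bot,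
    connOn_singleton _ _⟩, ?_⟩⟩
  · ext; simp
  · rintro T ⟨-, h, -⟩
    rw [eq_bot_iff]
    intro x y hxy
    obtain ⟨rfl, rfl⟩ := mem_of_restrictTo_eq h hxy
    exact (hxy.ne rfl).elim

/-- Removing a leaf does not change the number of spanning trees. -/
theorem ncard_treesOn_insert_leaf {G : SimpleGraph V} {A : Set V} {v w : V} (hv : v ∉ A)
    (hw : w ∈ A) (hvw : G.Adj v w) (huniq : ∀ u ∈ A, G.Adj v u → u = w) :
    (treesOn G (insert v A)).ncard = (treesOn G A).ncard := by
  classical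
  have hd : Disjoint {v} A := Set.disjoint_singleton_left.2 hv
  have hsplit : treesOn G (insert v A) = splitTrees G {v} A := by
    rw [Set.insert_eq]
    ext T
    refine ⟨fun hT => ⟨hT, connOn_singleton _ _, fun x hx y hy => ?_⟩, fun hT => hT.1⟩
    -- Folding the leaf `v` onto its only neighbour `w` keeps walks inside `A`, so the tree stays
    -- connected on `A`.
    have key := reachable_of_map (K := restrictTo T A) (fun x => if x ∈ A then x else w) ?_
      (hT.2.2.2 x (Or.inr hx) y (Or.inr hy))
    · simpa [hx, hy] using key
    rintro a b ⟨h, (rfl | ha), (rfl | hb)⟩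
    · exact (h.ne rfl).elim
    · have := huniq b hb (hT.1 h)
      simp [hv, this]
    · have := huniq a ha (hT.1 h.symm)
      simp [hv, this]
    · have : (restrictTo T A).Adj a b := ⟨h, ha, hb⟩
      simpa [ha, hb] using this.reachable
  have hcross : crossing G {v} A = {(v, w)} := by
    ext ⟨a, b⟩
    simp only [crossing, Set.mem_ofPred_eq, Set.mem_singleton_iff, Prod.mk.injEq]
    constructor
    · rintro ⟨rfl, hb, h⟩
      exact ⟨rfl, huniq b hb h⟩
    · rintro ⟨rfl, rfl⟩
      exact ⟨rfl, hw, hvw⟩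
  rw [hsplit, ncard_splitTrees hd (Set.singleton_nonempty v) ⟨w, hw⟩, hcross,
    ncard_treesOn_singleton, Set.ncard_singleton, one_mul, mul_one]

/-- Counting spanning trees is invariant under graph embeddings. -/
theorem ncard_treesOn_image {G : SimpleGraph V} {H : SimpleGraph W} (f : G ↪g H) (A : Set V) :
    (treesOn H (f '' A)).ncard = (treesOn G A).ncard := by
  classical
  have himg : treesOn H (f '' A) = (SimpleGraph.map f.toEmbedding) '' treesOn G A := by
    apply Set.Subset.antisymm
    · rintro T ⟨hle, hr, hac, hc⟩
      refine ⟨T.comap f.toEmbedding, ⟨?_, ?_, hac.of_comap _, ?_⟩, ?_⟩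
      · intro u v h
        exact f.map_adj_iff.1 (hle h)
      · ext u v
        refine ⟨fun h => h.1, fun h => ⟨h, ?_⟩⟩
        obtain ⟨⟨x, hx, hxu⟩, ⟨y, hy, hyv⟩⟩ := mem_of_restrictTo_eq hr h
        exact ⟨f.injective hxu ▸ hx, f.injective hyv ▸ hy⟩
      · intro u hu v hv
        have : Nonempty V := ⟨u⟩
        -- Walks in the image are pulled back along the left inverse `Function.invFun f`.
        have key := reachable_of_map (K := restrictTo (T.comap f.toEmbedding) A)
          (Function.invFun f) ?_ (hc (f u) ⟨u, hu, rfl⟩ (f v) ⟨v, hv, rfl⟩)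
        · simpa [Function.leftInverse_invFun f.injective _] using key
        rintro _ _ ⟨h, ⟨x, hx, rfl⟩, ⟨y, hy, rfl⟩⟩
        rw [Function.leftInverse_invFun f.injective x, Function.leftInverse_invFun f.injective y]
        exact Adj.reachable ⟨h, hx, hy⟩
      · ext x y
        rw [SimpleGraph.map_adj]
        constructor
        · rintro ⟨u, v, h, rfl, rfl⟩
          exact h
        · intro h
          obtain ⟨⟨u, hu, rfl⟩, ⟨v, hv, rfl⟩⟩ := mem_of_restrictTo_eq hr h
          exact ⟨u, v, h, rfl, rfl⟩
    · rintro _ ⟨T, ⟨hle, hr, hac, hc⟩, rfl⟩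
      refine ⟨?_, ?_, ?_, ?_⟩
      · intro x y h
        obtain ⟨u, v, huv, rfl, rfl⟩ := (SimpleGraph.map_adj _ _ _ _).1 h
        exact f.map_adj_iff.2 (hle huv)
      · ext x y
        rw [restrictTo_adj, and_iff_left_iff_imp]
        intro h
        obtain ⟨u, v, huv, rfl, rfl⟩ := (SimpleGraph.map_adj _ _ _ _).1 h
        obtain ⟨hu, hv⟩ := mem_of_restrictTo_eq hr huv
        exact ⟨⟨u, hu, rfl⟩, ⟨v, hv, rfl⟩⟩
      · rw [isAcyclic_iff_not_reachable]
        intro x y hxy hreach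
        obtain ⟨u, v, h, rfl, rfl⟩ := (SimpleGraph.map_adj _ _ _ _).1 hxy
        have : Nonempty V := ⟨u⟩
        refine isAcyclic_iff_not_reachable.1 hac u v h ?_
        have key := reachable_of_map (K := T.deleteEdges {s(u, v)}) (Function.invFun f) ?_ hreach
        · simpa [Function.leftInverse_invFun f.injective _] using key
        intro x y h
        rw [deleteEdges_adj] at h
        obtain ⟨h1, h2⟩ := h
        obtain ⟨u', v', h', rfl, rfl⟩ := (SimpleGraph.map_adj _ _ _ _).1 h1
        have e : ∀ z, Function.invFun f (f.toEmbedding z) = z :=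
          Function.leftInverse_invFun f.injective
        rw [e, e]
        refine Adj.reachable ?_
        rw [deleteEdges_adj]
        refine ⟨h', fun h3 => h2 ?_⟩
        simp only [Set.mem_singleton_iff, Sym2.eq_iff] at h3 ⊢
        rcases h3 with ⟨rfl, rfl⟩ | ⟨rfl, rfl⟩ <;> simp
      · rintro _ ⟨u, hu, rfl⟩ _ ⟨v, hv, rfl⟩
        refine reachable_of_map f (fun x y h => Adj.reachable ?_) (hc u hu v hv)
        exact ⟨(SimpleGraph.map_adj _ _ _ _).2 ⟨x, y, h.1, rfl, rfl⟩, ⟨x, h.2.1, rfl⟩,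
          ⟨y, h.2.2, rfl⟩⟩
  rw [himg, Set.ncard_image_of_injective _ (SimpleGraph.map_injective _)]

/-! ### Balanced cut edges as connected bipartitions -/

lemma connOn_supp {H T : SimpleGraph V} (hle : H ≤ T) (C : H.ConnectedComponent) :
    ConnOn T C.supp := by
  intro u hu v hv
  obtain ⟨p⟩ : H.Reachable u v := ConnectedComponent.exact (hu.trans hv.symm)
  induction p with
  | nil => exact Reachable.refl _
  | cons h _ ih =>
    have hw := (C.mem_supp_congr_adj h).1 hu
    exact (Adj.reachable (restrictTo_adj.2 ⟨hle h, hu, hw⟩)).trans (ih hw hv)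

/-- A tree on `2 * n` vertices is balanced if and only if its vertices can be divided into two
halves on each of which it is connected. -/
theorem exists_isBalancedCutEdge_iff [Finite V] {T : SimpleGraph V} (hT : T.IsTree) {n : ℕ}
    (hn : Nat.card V = 2 * n) (v₀ : V) :
    (∃ e, IsBalancedCutEdge T e) ↔
      ∃ A : Set V, v₀ ∈ A ∧ A.ncard = n ∧ ConnOn T A ∧ ConnOn T Aᶜ := by
  constructor
  · rintro ⟨e, -, C, D, hne, hall, hcard⟩
    have hcompl : ∀ {C D : (T.deleteEdges {e}).ConnectedComponent}, C ≠ D →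
        (∀ X, X = C ∨ X = D) → C.suppᶜ = D.supp := by
      intro C D hne hall
      ext x
      simp only [Set.mem_compl_iff, ConnectedComponent.mem_supp_iff]
      constructor
      · exact fun h => (hall _).resolve_left h
      · rintro rfl h
        exact hne h.symm
    have hsum := Set.ncard_add_ncard_compl C.supp
    rw [hcompl hne hall, hn] at hsum
    have hle : T.deleteEdges {e} ≤ T := deleteEdges_le _
    -- `A` is whichever of the two components contains `v₀`.
    rcases hall (connectedComponentMk _ v₀) with h | h
    · exact ⟨C.supp, h, by lia, connOn_supp hle C, hcompl hne hall ▸ connOn_supp hle D⟩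
    · exact ⟨D.supp, h, by lia, connOn_supp hle D,
        hcompl hne.symm (fun X => (hall X).symm) ▸ connOn_supp hle C⟩
  · rintro ⟨A, hv, hcard, hA, hB⟩
    have hsum := Set.ncard_add_ncard_compl A
    rw [hn] at hsum
    have hpos : 0 < A.ncard := (Set.ncard_pos (Set.toFinite _)).2 ⟨v₀, hv⟩
    have hne : Aᶜ.Nonempty := (Set.ncard_pos (Set.toFinite _)).1 (by lia)
    have hd : Disjoint A Aᶜ := disjoint_compl_right
    have hTT : T ∈ treesOn T Set.univ :=
      have : Nonempty V := ⟨v₀⟩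
      mem_treesOn_univ.2 ⟨le_rfl, hT⟩
    -- The cut edge is a tree edge from `A` to `Aᶜ`; paths inside either half avoid it, so the
    -- halves are the two components left after its deletion.
    obtain ⟨a, b, ha, hb, hab⟩ := exists_crossing hd ⟨v₀, hv⟩ hne
      (T := T) (by rw [Set.union_compl_self]; exact hTT.2.2.2)
    simp only at ha hb hab
    have hra : ∀ x ∈ A, (T.deleteEdges {s(a, b)}).Reachable x a := fun x hx =>
      (hA x hx a ha).mono (restrictTo_le_deleteEdges T a hb)
    have hrb : ∀ x ∈ Aᶜ, (T.deleteEdges {s(a, b)}).Reachable x b := fun x hx => by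
      rw [Sym2.eq_swap]
      exact (hB x hx b hb).mono (restrictTo_le_deleteEdges T b (Set.notMem_compl_iff.2 ha))
    have hnr := isAcyclic_iff_not_reachable.1 hT.isAcyclic a b hab
    have hsA : (connectedComponentMk (T.deleteEdges {s(a, b)}) a).supp = A := by
      ext x
      rw [ConnectedComponent.mem_supp_iff, ConnectedComponent.eq]
      refine ⟨fun h => ?_, hra x⟩
      by_contra hx
      exact hnr (h.symm.trans (hrb x hx))
    have hsB : (connectedComponentMk (T.deleteEdges {s(a, b)}) b).supp = Aᶜ := by
      ext x
      rw [ConnectedComponent.mem_supp_iff, ConnectedComponent.eq]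
      refine ⟨fun h hx => ?_, hrb x⟩
      exact hnr ((hra x hx).symm.trans h)
    refine ⟨s(a, b), hab, connectedComponentMk _ a, connectedComponentMk _ b, ?_, ?_, ?_⟩
    · exact fun h => hnr (ConnectedComponent.exact h)
    · intro X
      induction X using ConnectedComponent.ind with
      | h x =>
        by_cases hx : x ∈ A
        · exact Or.inl (ConnectedComponent.sound (hra x hx))
        · exact Or.inr (ConnectedComponent.sound (hrb x hx))
    · rw [hsA, hsB]
      lia

/-- An acyclic graph cannot be connected on both sides of two crossing bipartitions. -/
lemma not_connOn_of_crossing {T : SimpleGraph V} (hT : T.IsAcyclic) {A B : Set V}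
    (hA : ConnOn T A) (hA' : ConnOn T Aᶜ) (hB : ConnOn T B) (hB' : ConnOn T Bᶜ)
    (h₁ : (A ∩ B).Nonempty) (h₂ : (A \ B).Nonempty) (h₃ : (B \ A).Nonempty)
    (h₄ : (A ∪ B)ᶜ.Nonempty) : False := by
  obtain ⟨w, hw⟩ := h₁
  obtain ⟨x, hx⟩ := h₂
  obtain ⟨y, hy⟩ := h₃
  obtain ⟨z, hz⟩ := h₄
  rw [Set.compl_union] at hz
  -- A walk within `A` and a walk within `Aᶜ` each leave `B`. The two edges used must coincide by
  -- uniqueness of the crossing edge of `B`, yet one lies in `A` and the other in `Aᶜ`.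
  obtain ⟨a, b, hab, ha, hb⟩ := exists_adj_of_reachable B (hA w hw.1 x hx.1) hw.2 hx.2
  obtain ⟨c, d, hcd, hc, hd⟩ := exists_adj_of_reachable B (hA' y hy.2 z hz.1) hy.1 hz.2
  have := crossing_eq_of_isAcyclic hT disjoint_compl_right hB hB'
    (p := (a, b)) (q := (c, d)) ⟨ha, hb, hab.1⟩ ⟨hc, hd, hcd.1⟩
  simp only [Prod.mk.injEq] at this
  exact hcd.2.1 (this.1 ▸ hab.2.1)

/-! ### Staircases and the symmetries of the grid -/

lemma grid_adj {n : ℕ} {p q : Fin 2 × Fin n} :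
    (grid n).Adj p q ↔ (p.1 ≠ q.1 ∧ p.2 = q.2) ∨
      (p.1 = q.1 ∧ ((p.2 : ℕ) + 1 = q.2 ∨ (q.2 : ℕ) + 1 = p.2)) := by
  simp only [grid, boxProd_adj, pathGraph_two_eq_top, top_adj, pathGraph_adj]
  tauto

/-- The first `i` vertices of row `0` and the first `j` vertices of row `1`. -/
def staircase (n i j : ℕ) : Set (Fin 2 × Fin n) :=
  {p | (p.2 : ℕ) < if p.1 = 0 then i else j}

lemma mem_staircase {n i j : ℕ} {p : Fin 2 × Fin n} :
    p ∈ staircase n i j ↔ (p.1 = 0 ∧ (p.2 : ℕ) < i) ∨ (p.1 = 1 ∧ (p.2 : ℕ) < j) := by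
  obtain ⟨r, x⟩ := p
  rw [staircase, Set.mem_ofPred_eq]
  fin_cases r <;> simp

/-- The half turn of the grid. -/
def halfTurn (n : ℕ) : grid n ↪g grid n where
  toFun p := (p.1.rev, p.2.rev)
  inj' p q h := by simpa [Prod.ext_iff] using h
  map_rel_iff' {p q} := by
    change (grid n).Adj (p.1.rev, p.2.rev) (q.1.rev, q.2.rev) ↔ _
    simp only [grid_adj, Fin.rev_inj, Fin.val_rev, ne_eq]
    have := p.2.2
    have := q.2.2
    lia

/-- The exchange of the two rows. -/
def rowSwap (n : ℕ) : grid n ↪g grid n where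
  toFun p := (p.1.rev, p.2)
  inj' p q h := by simpa [Prod.ext_iff] using h
  map_rel_iff' {p q} := by
    change (grid n).Adj (p.1.rev, p.2) (q.1.rev, q.2) ↔ _
    simp only [grid_adj, Fin.rev_inj, ne_eq]

/-- The inclusion of a grid as the leftmost columns of a longer one. -/
def gridInclusion {k n : ℕ} (h : k ≤ n) : grid k ↪g grid n where
  toFun p := (p.1, Fin.castLE h p.2)
  inj' p q h := by simpa [Prod.ext_iff] using h
  map_rel_iff' {p q} := by
    change (grid n).Adj (p.1, Fin.castLE h p.2) (q.1, Fin.castLE h q.2) ↔ _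
    simp only [grid_adj, Fin.castLE_inj, Fin.val_castLE, ne_eq]

lemma rev_eq_zero_iff (r : Fin 2) : r.rev = 0 ↔ r = 1 := by revert r; decide

lemma rev_eq_one_iff (r : Fin 2) : r.rev = 1 ↔ r = 0 := by revert r; decide

lemma halfTurn_image_staircase {n i j : ℕ} (hij : i + j = n) :
    halfTurn n '' staircase n i j = (staircase n i j)ᶜ := by
  have hinv : ∀ p, halfTurn n (halfTurn n p) = p := fun p =>
    Prod.ext (Fin.rev_rev _) (Fin.rev_rev _)
  have key : ∀ p, halfTurn n p ∈ staircase n i j ↔ p ∉ staircase n i j := by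
    intro p
    have h := p.2.2
    have hr : p.1 = 0 ∨ p.1 = 1 := by
      generalize p.1 = r
      revert r; decide
    rw [mem_staircase, mem_staircase]
    have e : ((halfTurn n p).2 : ℕ) = n - (p.2 + 1) := Fin.val_rev _
    have e' : (halfTurn n p).1 = p.1.rev := rfl
    rw [e, e', rev_eq_zero_iff, rev_eq_one_iff]
    rcases hr with hr | hr <;> simp [hr] <;> lia
  ext p
  rw [Set.mem_compl_iff, ← key]
  exact ⟨fun ⟨q, hq, h⟩ => h ▸ (hinv q).symm ▸ hq, fun h => ⟨_, h, hinv p⟩⟩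

lemma rowSwap_image_staircase (n i j : ℕ) :
    rowSwap n '' staircase n i j = staircase n j i := by
  have hinv : ∀ p, rowSwap n (rowSwap n p) = p := fun p =>
    Prod.ext (Fin.rev_rev _) rfl
  have key : ∀ p i j, p ∈ staircase n i j → rowSwap n p ∈ staircase n j i := by
    intro p i j
    rw [mem_staircase, mem_staircase]
    have e : ((rowSwap n p).2 : ℕ) = p.2 := rfl
    have e' : (rowSwap n p).1 = p.1.rev := rfl
    rw [e, e', rev_eq_zero_iff, rev_eq_one_iff]
    exact Or.symm
  ext p
  exact ⟨fun ⟨q, hq, h⟩ => h ▸ key q i j hq, fun h => ⟨_, key p j i h, hinv p⟩⟩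

lemma gridInclusion_image_univ {k n : ℕ} (h : k ≤ n) :
    gridInclusion h '' Set.univ = staircase n k k := by
  ext p
  rw [staircase, Set.mem_ofPred_eq, ite_self]
  constructor
  · rintro ⟨q, -, rfl⟩
    exact q.2.2
  · exact fun hp => ⟨(p.1, ⟨p.2, hp⟩), trivial, rfl⟩

/-! ### Spanning trees of staircases -/

lemma ncard_treesOn_staircase_square {k n : ℕ} (hk : 1 ≤ k) (h : k ≤ n) :
    (treesOn (grid n) (staircase n k k)).ncard = numTrees k := by
  have : Nonempty (Fin 2 × Fin k) := ⟨(0, ⟨0, hk⟩)⟩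
  rw [← gridInclusion_image_univ h, ncard_treesOn_image, numTrees, if_neg (by lia)]
  congr 1
  ext T
  exact mem_treesOn_univ

/-- As `j ≤ i`, the vertex of row `1` in column `i` is absent, so the new vertex `(0, i)` is a leaf
attached to `(0, i - 1)`. -/
lemma ncard_treesOn_staircase_succ {n i j : ℕ} (hi : 1 ≤ i) (hji : j ≤ i) (hin : i < n) :
    (treesOn (grid n) (staircase n (i + 1) j)).ncard =
      (treesOn (grid n) (staircase n i j)).ncard := by
  have hins : staircase n (i + 1) j = insert (0, ⟨i, hin⟩) (staircase n i j) := by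
    ext ⟨r, x⟩
    rw [Set.mem_insert_iff, mem_staircase, mem_staircase]
    simp only [Prod.mk.injEq, Fin.ext_iff]
    lia
  rw [hins]
  apply ncard_treesOn_insert_leaf (w := (0, ⟨i - 1, by lia⟩))
  · simp [mem_staircase]
  · simp [mem_staircase]; lia
  · simp [grid_adj]; lia
  · rintro ⟨r, x⟩ hx hadj
    rw [mem_staircase] at hx
    rw [grid_adj] at hadj
    simp only [Prod.mk.injEq, Fin.ext_iff] at *
    simp at *
    lia

/-- Leaves are stripped until a square grid remains, or a single vertex when `j = 0`; the latter is
where the convention `numTrees 0 = 1` enters. -/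
lemma ncard_treesOn_staircase_of_le {n i j : ℕ} (hi : 1 ≤ i) (hji : j ≤ i) (hin : i ≤ n) :
    (treesOn (grid n) (staircase n i j)).ncard = numTrees j := by
  rcases Nat.eq_zero_or_pos j with rfl | hj
  · induction i, hi using Nat.le_induction with
    | base =>
      have : staircase n 1 0 = {(0, ⟨0, hin⟩)} := by
        ext ⟨r, x⟩
        rw [mem_staircase]
        simp only [Set.mem_singleton_iff, Prod.mk.injEq, Fin.ext_iff]
        lia
      rw [this, ncard_treesOn_singleton, numTrees, if_pos rfl]
    | succ i hi ih =>
      rw [ncard_treesOn_staircase_succ hi (Nat.zero_le _) hin]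
      exact ih (by lia) (Nat.zero_le _)
  · clear hi
    induction i, hji using Nat.le_induction with
    | base => exact ncard_treesOn_staircase_square hj hin
    | succ i hji ih =>
      rw [ncard_treesOn_staircase_succ (by lia) hji hin]
      exact ih (by lia)

theorem ncard_treesOn_staircase {n i j : ℕ} (hij : 1 ≤ i + j) (hi : i ≤ n) (hj : j ≤ n) :
    (treesOn (grid n) (staircase n i j)).ncard = numTrees (min i j) := by
  rcases le_total j i with h | h
  · rw [min_eq_right h]
    exact ncard_treesOn_staircase_of_le (by lia) h hi
  · rw [min_eq_left h, ← rowSwap_image_staircase, ncard_treesOn_image]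
    exact ncard_treesOn_staircase_of_le (by lia) h hj

theorem ncard_treesOn_compl_staircase {n i j : ℕ} (hij : i + j = n) (hn : 1 ≤ n) :
    (treesOn (grid n) (staircase n i j)ᶜ).ncard = numTrees (min i j) := by
  rw [← halfTurn_image_staircase hij, ncard_treesOn_image]
  exact ncard_treesOn_staircase (by lia) (by lia) (by lia)

/-! ### Size of a staircase and the edges leaving it -/

/-- The rungs of the grid leaving a staircase. -/
def rungs (n i j : ℕ) : Set ((Fin 2 × Fin n) × (Fin 2 × Fin n)) :=
  {q | q.1.1 ≠ q.2.1 ∧ q.1.2 = q.2.2 ∧ q.1 ∈ staircase n i j ∧ q.2 ∉ staircase n i j}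

/-- A rung leaving the staircase is determined by its column, and the columns that occur are those
reached by exactly one of the two rows. -/
lemma ncard_rungs {n i j : ℕ} (hi : i ≤ n) (hj : j ≤ n) :
    (rungs n i j).ncard = max i j - min i j := by
  have hinj : Set.InjOn (fun q : (Fin 2 × Fin n) × (Fin 2 × Fin n) => (q.1.2 : ℕ))
      (rungs n i j) := by
    rintro ⟨⟨r, x⟩, ⟨s, y⟩⟩ ⟨h1, h2, h3, h4⟩ ⟨⟨r', x'⟩, ⟨s', y'⟩⟩ ⟨k1, k2, k3, k4⟩ h
    rw [mem_staircase] at h3 h4 k3 k4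
    simp only [Prod.mk.injEq, Fin.ext_iff] at *
    lia
  have himg : (fun q : (Fin 2 × Fin n) × (Fin 2 × Fin n) => (q.1.2 : ℕ)) '' rungs n i j =
      (Finset.Ico (min i j) (max i j) : Finset ℕ) := by
    ext x
    rw [Finset.mem_coe, Finset.mem_Ico]
    constructor
    · rintro ⟨⟨⟨r, x⟩, ⟨s, y⟩⟩, ⟨h1, h2, h3, h4⟩, rfl⟩
      rw [mem_staircase] at h3 h4
      simp only [Fin.ext_iff] at *
      have := r.2
      have := s.2
      simp at *
      lia
    · intro hx
      have hxn : x < n := by lia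
      rcases lt_or_ge x i with h | h
      · refine ⟨((0, ⟨x, hxn⟩), (1, ⟨x, hxn⟩)), ⟨?_, rfl, ?_, ?_⟩, rfl⟩
        · simp
        · simp [mem_staircase, h]
        · simp [mem_staircase]; lia
      · refine ⟨((1, ⟨x, hxn⟩), (0, ⟨x, hxn⟩)), ⟨?_, rfl, ?_, ?_⟩, rfl⟩
        · simp
        · simp [mem_staircase]; lia
        · simp [mem_staircase, h]
  rw [← hinj.ncard_image, himg, Set.ncard_coe_finset, Nat.card_Ico]

lemma ncard_crossing_row {n : ℕ} :
    (crossing (grid n) (staircase n n 0) (staircase n n 0)ᶜ).ncard = n := by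
  have : crossing (grid n) (staircase n n 0) (staircase n n 0)ᶜ = rungs n n 0 := by
    ext ⟨⟨r, x⟩, ⟨s, y⟩⟩
    simp only [crossing, rungs, Set.mem_ofPred_eq, Set.mem_compl_iff, mem_staircase, grid_adj,
      Fin.ext_iff]
    have := x.2
    have := y.2
    simp
    lia
  rw [this, ncard_rungs le_rfl (Nat.zero_le _)]
  simp

/-- Besides the rungs, each row contributes the horizontal edge at its end; both exist because `i`
and `j` lie strictly between `0` and `n`. -/
lemma ncard_crossing_staircase {n i j : ℕ} (hi : 1 ≤ i) (hin : i < n) (hj : 1 ≤ j)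
    (hjn : j < n) : (crossing (grid n) (staircase n i j) (staircase n i j)ᶜ).ncard =
      max i j - min i j + 2 := by
  have hun : crossing (grid n) (staircase n i j) (staircase n i j)ᶜ =
      insert ((0, ⟨i - 1, by lia⟩), (0, ⟨i, hin⟩))
        (insert ((1, ⟨j - 1, by lia⟩), (1, ⟨j, hjn⟩)) (rungs n i j)) := by
    ext ⟨⟨r, x⟩, ⟨s, y⟩⟩
    simp only [crossing, rungs, Set.mem_ofPred_eq, Set.mem_compl_iff, mem_staircase, grid_adj,
      Fin.ext_iff, Set.mem_insert_iff, Prod.mk.injEq]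
    fin_cases r <;> fin_cases s <;> simp <;> lia
  rw [hun, Set.ncard_insert_of_notMem _ (Set.toFinite _),
    Set.ncard_insert_of_notMem _ (Set.toFinite _), ncard_rungs hin.le hjn.le]
  · simp [rungs]
  · simp [rungs]

lemma ncard_staircase {n i j : ℕ} (hi : i ≤ n) (hj : j ≤ n) :
    (staircase n i j).ncard = i + j := by
  have hrow : ∀ (r : Fin 2) (k : ℕ), k ≤ n →
      ((fun x : Fin n => (r, x)) '' {x | (x : ℕ) < k}).ncard = k := by
    intro r k hk
    rw [Set.ncard_image_of_injective _ (Prod.mk_right_injective r),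
      ← Set.ncard_image_of_injective _ Fin.val_injective]
    have : Fin.val '' {x : Fin n | (x : ℕ) < k} = (Finset.range k : Finset ℕ) := by
      ext x
      simp only [Set.mem_image, Set.mem_ofPred_eq, Finset.coe_range, Set.mem_Iio]
      exact ⟨fun ⟨y, hy, h⟩ => h ▸ hy, fun h => ⟨⟨x, by lia⟩, h, rfl⟩⟩
    rw [this, Set.ncard_coe_finset, Finset.card_range]
  have hun : staircase n i j = (fun x : Fin n => ((0 : Fin 2), x)) '' {x | (x : ℕ) < i} ∪
      (fun x : Fin n => ((1 : Fin 2), x)) '' {x | (x : ℕ) < j} := by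
    ext ⟨r, x⟩
    simp [mem_staircase, eq_comm, and_comm]
  rw [hun, Set.ncard_union_eq, hrow _ _ hi, hrow _ _ hj]
  rw [Set.disjoint_left]
  rintro _ ⟨x, -, rfl⟩ ⟨y, -, h⟩
  simp at h

/-! ### Connected halves of the grid are staircases -/

/-- A connected set with vertices on both sides of a cut between consecutive columns contains a
horizontal edge across it. -/
lemma exists_horizontal_edge {n : ℕ} {A : Set (Fin 2 × Fin n)} (hA : ConnOn (grid n) A)
    {p q : Fin 2 × Fin n} (hp : p ∈ A) (hq : q ∈ A) {x y : Fin n} (hxy : (x : ℕ) + 1 = y)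
    (hpx : p.2 ≤ x) (hyq : y ≤ q.2) : ∃ r, (r, x) ∈ A ∧ (r, y) ∈ A := by
  obtain ⟨⟨r, u⟩, ⟨s, v⟩, ⟨hadj, ha, hb⟩, h1, h2⟩ :=
    exists_adj_of_reachable {p : Fin 2 × Fin n | p.2 ≤ x} (hA p hp q hq) hpx (by
      simp only [Set.mem_ofPred_eq, Fin.le_def] at *
      lia)
  rw [grid_adj] at hadj
  simp only [Set.mem_ofPred_eq, Fin.le_def] at *
  have hu : u = x := by
    rw [Fin.ext_iff]
    rcases hadj with h | h
    · have := Fin.ext_iff.1 h.2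
      lia
    · lia
  have hrs : r = s ∧ v = y := by
    rcases hadj with h | h
    · have := Fin.ext_iff.1 h.2
      lia
    · exact ⟨h.1, Fin.ext (by lia)⟩
  obtain ⟨rfl, rfl⟩ := hrs
  subst hu
  exact ⟨r, ha, hb⟩

/-- If a set of `n` vertices meets every column then it has only one vertex in each column. -/
lemma not_mem_of_forall_column {n : ℕ} {A : Set (Fin 2 × Fin n)} (hcard : A.ncard = n)
    (hcol : ∀ x, ∃ r, (r, x) ∈ A) {r s : Fin 2} (hrs : r ≠ s) {x : Fin n} (h : (r, x) ∈ A) :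
    (s, x) ∉ A := by
  intro h'
  -- With two vertices in column `x`, deleting one leaves fewer than `n` vertices still meeting all
  -- `n` columns.
  have hs : Prod.snd '' (A \ {(r, x)}) = Set.univ := by
    refine Set.eq_univ_of_forall fun y => ?_
    by_cases hy : y = x
    · subst hy
      exact ⟨(s, y), ⟨h', by simpa using hrs.symm⟩, rfl⟩
    · obtain ⟨t, ht⟩ := hcol y
      exact ⟨(t, y), ⟨ht, by simp [hy]⟩, rfl⟩
  have h1 := Set.ncard_image_le (f := Prod.snd) (Set.toFinite (A \ {(r, x)}))
  have h2 := Set.ncard_sdiff_singleton_lt_of_mem h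
  rw [hs, Set.ncard_univ, Nat.card_fin] at h1
  lia

/-- If `(r, x)` were missing, `A` would have to pass from column `x` to column `y` along the other
row, and so contain all of column `y`. It then meets every column, so having only `n` vertices it
cannot contain two in one column. -/
lemma mem_of_mem_succ {n : ℕ} {A : Set (Fin 2 × Fin n)} (hcard : A.ncard = n)
    (hA : ConnOn (grid n) A) (hA' : ConnOn (grid n) Aᶜ) {r₀ : Fin 2} {x₀ : Fin n}
    (h₀ : (r₀, x₀) ∈ A) (hx₀ : (x₀ : ℕ) = 0) {r : Fin 2} {x y : Fin n} (hxy : (x : ℕ) + 1 = y)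
    (hy : (r, y) ∈ A) : (r, x) ∈ A := by
  by_contra hx
  obtain ⟨s, hsx, hsy⟩ := exists_horizontal_edge hA h₀ hy hxy (by rw [Fin.le_def]; lia) le_rfl
  have hsr : s ≠ r := by
    rintro rfl
    exact hx hsx
  have hall : ∀ t, (t, y) ∈ A := fun t => by
    have : t = r ∨ t = s := by lia
    rcases this with rfl | rfl <;> assumption
  refine not_mem_of_forall_column hcard (fun z => ?_) hsr hsy hy
  rcases lt_trichotomy z y with hz | rfl | hz
  · obtain ⟨t, ht, -⟩ := exists_horizontal_edge (x := z)
      (y := ⟨z + 1, by rw [Fin.lt_def] at hz; lia⟩) hA h₀ hy rfl (by rw [Fin.le_def]; lia) hz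
    exact ⟨t, ht⟩
  · exact ⟨r, hy⟩
  -- If a column `z` to the right of `y` missed `A`, then `Aᶜ` would join `(r, x)` to column `z`
  -- through column `y`, which lies wholly in `A`.
  · by_contra! hcon
    rw [Fin.lt_def] at hz
    obtain ⟨t, ht, -⟩ := exists_horizontal_edge (x := y) (y := ⟨y + 1, by lia⟩) hA' hx (hcon 0)
      rfl (by rw [Fin.le_def]; simp; lia) (by rw [Fin.le_def]; simp; lia)
    exact ht (hall t)

lemma exists_lt_iff_of_antitone {n : ℕ} (p : Fin n → Prop)
    (hp : ∀ x y : Fin n, (x : ℕ) + 1 = y → p y → p x) : ∃ i ≤ n, ∀ x, p x ↔ (x : ℕ) < i := by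
  induction n with
  | zero => exact ⟨0, le_rfl, fun x => x.elim0⟩
  | succ n ih =>
    obtain ⟨i, hi, h⟩ := ih (fun x => p x.castSucc) fun x y hxy => hp _ _ (by simpa using hxy)
    by_cases hl : p (Fin.last n)
    · have hall : ∀ k : ℕ, ∀ x : Fin (n + 1), (x : ℕ) + k = n → p x := by
        intro k
        induction k with
        | zero =>
          intro x hx
          have : x = Fin.last n := Fin.ext (by simpa using hx)
          exact this ▸ hl
        | succ k ihk =>
          intro x hx
          exact hp x ⟨x + 1, by lia⟩ rfl (ihk _ (by simp; lia))
      exact ⟨n + 1, le_rfl, fun x => ⟨fun _ => x.2, fun _ => hall (n - x) x (by lia)⟩⟩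
    · refine ⟨i, by lia, fun x => ?_⟩
      induction x using Fin.lastCases with
      | last => simp [hl, hi]
      | cast x => simpa using h x

/-- The only halves of the grid that are connected with connected complement are staircases. -/
theorem eq_staircase {n : ℕ} (hn : 1 ≤ n) {A : Set (Fin 2 × Fin n)} (hcard : A.ncard = n)
    (hA : ConnOn (grid n) A) (hA' : ConnOn (grid n) Aᶜ) (h₀ : (0, ⟨0, hn⟩) ∈ A) :
    ∃ i ∈ Finset.Icc 1 n, A = staircase n i (n - i) := by
  obtain ⟨i, hi, hi'⟩ := exists_lt_iff_of_antitone (fun x => ((0 : Fin 2), x) ∈ A)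
    fun x y hxy => mem_of_mem_succ hcard hA hA' h₀ rfl hxy
  obtain ⟨j, hj, hj'⟩ := exists_lt_iff_of_antitone (fun x => ((1 : Fin 2), x) ∈ A)
    fun x y hxy => mem_of_mem_succ hcard hA hA' h₀ rfl hxy
  have hAs : A = staircase n i j := by
    ext ⟨r, x⟩
    rw [mem_staircase]
    fin_cases r
    · simpa using hi' x
    · simpa using hj' x
  have hsum : i + j = n := by rw [← ncard_staircase hi hj, ← hAs, hcard]
  have hpos : 0 < i := (hi' _).1 h₀
  refine ⟨i, Finset.mem_Icc.2 ⟨hpos, hi⟩, ?_⟩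
  rw [hAs]
  congr 1
  lia

/-! ### The balanced trees as a disjoint union over staircases -/

/-- The two bipartitions cross: the four witnesses below lie in both staircases, only the first,
only the second, and neither. -/
lemma disjoint_splitTrees_staircase {n i j : ℕ} (hi : 1 ≤ i) (hij : i < j) (hj : j ≤ n) :
    Disjoint (splitTrees (grid n) (staircase n i (n - i)) (staircase n i (n - i))ᶜ)
      (splitTrees (grid n) (staircase n j (n - j)) (staircase n j (n - j))ᶜ) := by
  rw [Set.disjoint_left]
  rintro T ⟨hT, hA, hA'⟩ ⟨-, hB, hB'⟩
  refine not_connOn_of_crossing hT.2.2.1 hA hA' hB hB' ?_ ?_ ?_ ?_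
  · refine ⟨(0, ⟨0, by lia⟩), ?_⟩
    simp [mem_staircase]
    lia
  · refine ⟨(1, ⟨n - j, by lia⟩), ?_⟩
    simp [mem_staircase]
    lia
  · refine ⟨(0, ⟨i, by lia⟩), ?_⟩
    simp [mem_staircase]
    lia
  · refine ⟨(1, ⟨n - 1, by lia⟩), ?_⟩
    simp [mem_staircase]
    lia

lemma balancedSpanningTrees_grid {n : ℕ} (hn : 1 ≤ n) :
    balancedSpanningTrees (grid n) = ⋃ i ∈ (Finset.Icc 1 n : Set ℕ),
      splitTrees (grid n) (staircase n i (n - i)) (staircase n i (n - i))ᶜ := by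
  have hne : Nonempty (Fin 2 × Fin n) := ⟨(0, ⟨0, hn⟩)⟩
  have hcard : Nat.card (Fin 2 × Fin n) = 2 * n := by simp
  ext T
  simp only [Set.mem_iUnion, splitTrees, Set.mem_ofPred_eq, Set.union_compl_self,
    mem_treesOn_univ, balancedSpanningTrees, exists_prop, SetLike.mem_coe]
  constructor
  · rintro ⟨hT, he⟩
    obtain ⟨A, h₀, hA, hc, hc'⟩ :=
      (exists_isBalancedCutEdge_iff hT.2 hcard (0, ⟨0, hn⟩)).1 he
    obtain ⟨i, hi, rfl⟩ := eq_staircase hn hA (hc.mono fun _ _ _ _ h => hT.1 h)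
      (hc'.mono fun _ _ _ _ h => hT.1 h) h₀
    exact ⟨i, hi, hT, hc, hc'⟩
  · rintro ⟨i, hi, hT, hc, hc'⟩
    rw [Finset.mem_Icc] at hi
    refine ⟨hT, (exists_isBalancedCutEdge_iff hT.2 hcard (0, ⟨0, hn⟩)).2
      ⟨staircase n i (n - i), ?_, ?_, hc, hc'⟩⟩
    · simp [mem_staircase]
      lia
    · rw [ncard_staircase hi.2 (by lia)]
      lia

lemma numBalanced_eq_sum_ncard {n : ℕ} (hn : 1 ≤ n) :
    numBalanced n = ∑ i ∈ Finset.Icc 1 n,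
      (splitTrees (grid n) (staircase n i (n - i)) (staircase n i (n - i))ᶜ).ncard := by
  rw [numBalanced, balancedSpanningTrees_grid hn, Set.Finite.ncard_biUnion (Set.toFinite _)
    (fun _ _ => Set.toFinite _), finsum_mem_coe_finset]
  intro i hi j hj hij
  rw [Finset.mem_coe, Finset.mem_Icc] at hi hj
  rcases lt_or_gt_of_ne hij with h | h
  · exact disjoint_splitTrees_staircase hi.1 h hj.2
  · exact (disjoint_splitTrees_staircase hj.1 h hi.2).symm

lemma ncard_splitTrees_staircase {n i : ℕ} (hi : 1 ≤ i) (hin : i ≤ n) :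
    (splitTrees (grid n) (staircase n i (n - i)) (staircase n i (n - i))ᶜ).ncard =
      numTrees (min i (n - i)) ^ 2 *
        (crossing (grid n) (staircase n i (n - i)) (staircase n i (n - i))ᶜ).ncard := by
  rw [ncard_splitTrees disjoint_compl_right,
    ncard_treesOn_staircase (by lia) hin (by lia),
    ncard_treesOn_compl_staircase (by lia) (by lia), sq]
  · refine ⟨(0, ⟨0, by lia⟩), ?_⟩
    simp [mem_staircase]
    lia
  · refine ⟨(1, ⟨n - 1, by lia⟩), ?_⟩
    simp [mem_staircase]
    lia

/-- The number of balanced spanning trees, summed over the number of vertices of the upper row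
lying in the same half as the first one. -/
theorem numBalanced_eq {n : ℕ} (hn : 1 ≤ n) :
    numBalanced n = n + ∑ i ∈ Finset.Ico 1 n,
      (max i (n - i) - min i (n - i) + 2) * numTrees (min i (n - i)) ^ 2 := by
  -- The term `i = n` is separated: its halves are the two rows, and it contributes the summand `n`.
  rw [numBalanced_eq_sum_ncard hn, ← Finset.Ico_insert_right hn,
    Finset.sum_insert Finset.right_notMem_Ico]
  congr 1
  · rw [ncard_splitTrees_staircase hn le_rfl, Nat.sub_self, ncard_crossing_row]
    simp [numTrees]
  · refine Finset.sum_congr rfl fun i hi => ?_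
    rw [Finset.mem_Ico] at hi
    rw [ncard_splitTrees_staircase hi.1 hi.2.le,
      ncard_crossing_staircase hi.1 hi.2 (by lia) (by lia), mul_comm]

/-! ### Folding the sum about its middle -/

/-- Substitute `t = m - i`: here `i` is the minimum and the difference is `n - 2 * i = n - 2 * m + 2
* t`. Starting at `t = a` lets `a = 1` omit the term `i = m`. -/
lemma sum_left_half (f : ℕ → ℕ) {m n a : ℕ} (hn : 2 * m ≤ n) :
    ∑ i ∈ Finset.Ico 1 (m + 1 - a),
        (max i (n - i) - min i (n - i) + 2) * f (min i (n - i)) =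
      ∑ t ∈ Finset.Ico a m, (n - 2 * m + 2 * t + 2) * f (m - t) := by
  refine Finset.sum_nbij' (fun i => m - i) (fun t => m - t) ?_ ?_ ?_ ?_ ?_
  · intro i; simp only [Finset.mem_Ico]; lia
  · intro i; simp only [Finset.mem_Ico]; lia
  · intro i; simp only [Finset.mem_Ico]; lia
  · intro i; simp only [Finset.mem_Ico]; lia
  · intro i hi
    rw [Finset.mem_Ico] at hi
    congr 2 <;> lia

/-- The mirror image under `i ↦ n - i`: with `t = i - (n - m)` the minimum is `n - i = m - t`,
giving the same sum as the left half. -/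
lemma sum_right_half (f : ℕ → ℕ) {m n a : ℕ} (hn : 2 * m ≤ n) :
    ∑ i ∈ Finset.Ico (n - m + a) n,
        (max i (n - i) - min i (n - i) + 2) * f (min i (n - i)) =
      ∑ t ∈ Finset.Ico a m, (n - 2 * m + 2 * t + 2) * f (m - t) := by
  refine Finset.sum_nbij' (fun i => i - (n - m)) (fun t => n - m + t) ?_ ?_ ?_ ?_ ?_
  · intro i; simp only [Finset.mem_Ico]; lia
  · intro i; simp only [Finset.mem_Ico]; lia
  · intro i; simp only [Finset.mem_Ico]; lia
  · intro i; simp only [Finset.mem_Ico]; lia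
  · intro i hi
    rw [Finset.mem_Ico] at hi
    congr 2 <;> lia

end BalancedTrees

open BalancedTrees in
theorem lemma1 (m : ℕ) (hm : 1 ≤ m) :
    (∀ n : ℕ, n = 2 * m + 1 →
      BalancedTrees.numBalanced n =
        n + ∑ i ∈ Finset.range m, (6 + 4 * i) * BalancedTrees.numTrees (m - i) ^ 2) ∧
    (∀ n : ℕ, n = 2 * m →
      BalancedTrees.numBalanced n =
        n + 2 * BalancedTrees.numTrees m ^ 2 +
          ∑ i ∈ Finset.Ico 1 m, (4 + 4 * i) * BalancedTrees.numTrees (m - i) ^ 2) := by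
  constructor
  · rintro n hn
    -- For odd `n` there is no middle term; the two equal halves give the coefficient `2 * (1 + 2 *
    -- t + 2) = 6 + 4 * t`.
    have hl := sum_left_half (fun k => numTrees k ^ 2) (m := m) (n := n) (a := 0) (by lia)
    have hr := sum_right_half (fun k => numTrees k ^ 2) (m := m) (n := n) (a := 0) (by lia)
    rw [numBalanced_eq (by lia),
      ← Finset.sum_Ico_consecutive _ (show 1 ≤ m + 1 - 0 by lia) (show m + 1 - 0 ≤ n by lia),
      show Finset.Ico (m + 1 - 0) n = Finset.Ico (n - m + 0) n by congr 1; lia, hl, hr,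
      ← Finset.sum_add_distrib, Finset.range_eq_Ico]
    congr 1
    refine Finset.sum_congr rfl fun i _ => ?_
    rw [← add_mul]
    congr 1
    lia
  · rintro n hn
    -- For even `n` the term `i = m` is its own mirror image and counts once, with coefficient `2`;
    -- the other terms pair up to `2 * (2 * t + 2) = 4 + 4 * t`.
    have hl := sum_left_half (fun k => numTrees k ^ 2) (m := m) (n := n) (a := 1) (by lia)
    have hr := sum_right_half (fun k => numTrees k ^ 2) (m := m) (n := n) (a := 1) (by lia)
    rw [numBalanced_eq (by lia),
      ← Finset.sum_Ico_consecutive _ (show 1 ≤ m + 1 - 1 by lia) (show m + 1 - 1 ≤ n by lia),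
      Finset.sum_eq_sum_Ico_succ_bot (show m + 1 - 1 < n by lia),
      show Finset.Ico (m + 1 - 1 + 1) n = Finset.Ico (n - m + 1) n by congr 1; lia, hl, hr]
    have hmid : max (m + 1 - 1) (n - (m + 1 - 1)) - min (m + 1 - 1) (n - (m + 1 - 1)) + 2 = 2 := by
      lia
    have hmin : min (m + 1 - 1) (n - (m + 1 - 1)) = m := by lia
    have hs : ∑ i ∈ Finset.Ico 1 m, (4 + 4 * i) * numTrees (m - i) ^ 2 =
        ∑ t ∈ Finset.Ico 1 m, (n - 2 * m + 2 * t + 2) * numTrees (m - t) ^ 2 +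
        ∑ t ∈ Finset.Ico 1 m, (n - 2 * m + 2 * t + 2) * numTrees (m - t) ^ 2 := by
      rw [← Finset.sum_add_distrib]
      refine Finset.sum_congr rfl fun i _ => ?_
      rw [← add_mul]
      congr 1
      lia
    rw [hmid, hmin, hs]
    ring
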